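/- **Theorem (Boolean conjunctive query answering with the isomorphic chase with resumption over Shy rules).** *Setting.* Fix a relational schema, a non-empty set of constants, and a set of variables. A rule $\sigma$ is an existential rule $\varphi(\bar x,\bar y)\to\exists \bar z\,\psi(\bar x,\bar z)$ whose body $\varphi$ is a finite conjunction of atoms and whose head $\psi$ is a single atom (constants are allowed); the existential variables of distinct rules are regarded as distinct. A database is a finite set of facts over constants. A BCQ $q$ is the existential closure of a finite conjunction of atoms, $\mathsf{vars}(q)$ is its set of variables, and $I\models q$ means that there is a homomorphism (fixing constants) from the atoms of $q$ to the set of facts $I$. *Shy.* Let $\Sigma$ be a set of rules. A position $p[i]$ is *invaded* by an existential variable $y$ if some $\sigma\in\Sigma$ has head $p(t_1,\dots,t_k)$ and either $t_i=y$ with $y$ existential in $\sigma$, or $t_i$ is a body variable of $\sigma$ all of whose occurrences in the body are at positions invaded by $y$ (least such relation). A variable occurring in the body of $\sigma$ is *attacked* by $y$ if it occurs there only at positions invaded by $y$, and *protected* if it is attacked by no $y$. $\Sigma$ is *Shy* if for each $\sigma\in\Sigma$: (i) every variable occurring in more than one body atom is protected; and (ii) two distinct universally quantified variables that are not protected and occur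 both in the head and in two different body atoms are not attacked by the same existential variable. *Chases.* The oblivious chase $\mathrm{ochase}(D,\Sigma)$ is the set of facts obtained from $D$ by firing every homomorphism from the body of a rule exactly once, each firing adding the head with its existential variables replaced by pairwise distinct new labelled nulls. Two facts are isomorphic if there is a homomorphism from one to the other (fixing constants) whose inverse is also a homomorphism. A result $\mathrm{ichase}(I,\Sigma)$ of the isomorphic chase of a set of facts $I$ is obtained by finitely many such firings, one at a time and in any order, where a firing is performed only if the resulting head fact is not isomorphic to a fact already present, until no further firing is possible. For a set of facts $I$, $\lceil I\rfloor$ denotes $I$ with its nulls frozen, i.e. regarded as new constants. The isomorphic chase with resumption is given by $\mathrm{ichase}_r(D,\Sigma,0)=D$ and $\mathrm{ichase}_r(D,\Sigma,i)=\mathrm{ichase}(\lceil \mathrm{ichase}_r(D,\Sigma,i-1)\rfloor,\Sigma)$ for $i\ge 1$. *Statement.* Let $\Sigma$ be a finite Shy set of rules, $D$ a database and $q$ a BCQ. Then $\mathrm{ichase}_r(D,\Sigma,|\mathsf{vars}(q)|+1)$ exists (some sequence of firings terminates in every round), and for every result of it, whatever the order of the firings and the choice of the new nulls, $$\mathrm{ochase}(D,\Sigma)\models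 q\quad\Longleftrightarrow\quad \mathrm{ichase}_r(D,\Sigma,|\mathsf{vars}(q)|+1)\models q .$$ -/

import Mathlib

namespace Chase

universe u v w z

/-! ### Syntax -/

/-- Terms of rules and queries: constants from `C` and variables from `V`. -/
inductive RTerm (C : Type v) (V : Type w) : Type (max v w)
  | const (c : C)
  | var (x : V)

/-- An atom `p(t₁, …, tₖ)` with arguments from `T`, where `k = ar p` is the arity of `p`.
A fact is an atom whose arguments are constants and labelled nulls. -/
structure Atom {P : Type u} (ar : P → ℕ) (T : Type v) : Type (max u v) where
  pred : P
  args : Fin (ar pred) → T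

section
variable {P : Type u} {ar : P → ℕ} {C : Type v} {V : Type w} {T : Type z}

/-- Apply a map of terms to all arguments of an atom. -/
def Atom.map {T' : Type w} (f : T → T') (a : Atom ar T) : Atom ar T' :=
  ⟨a.pred, fun i => f (a.args i)⟩

/-- The value of a term when constants are read through `ι` and variables through `θ`. -/
def RTerm.eval (ι : C → T) (θ : V → T) : RTerm C V → T
  | .const c => ι c
  | .var x => θ x

/-- The fact obtained from an atom by applying the substitution `θ`. -/
def Atom.inst (ι : C → T) (θ : V → T) (a : Atom ar (RTerm C V)) : Atom ar T :=
  ⟨a.pred, fun i => (a.args i).eval ι θ⟩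

/-- The set of variables of an atom. -/
def Atom.vars (a : Atom ar (RTerm C V)) : Set V := {x | ∃ i, a.args i = .var x}

/-- The set of variables of a conjunction of atoms. -/
def conjVars (l : List (Atom ar (RTerm C V))) : Set V := {x | ∃ a ∈ l, x ∈ a.vars}

end

/-- An existential rule `φ(x̄, ȳ) → ∃ z̄ ψ(x̄, z̄)`: the body is a conjunction of atoms, the head is
an atom. The variables of the body are universally quantified; the variables of the head that do
not occur in the body are existentially quantified. -/
structure Rule {P : Type u} (ar : P → ℕ) (C : Type v) (V : Type w) : Type (max u v w) where
  body : List (Atom ar (RTerm C V))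
  head : Atom ar (RTerm C V)

section
variable {P : Type u} {ar : P → ℕ} {C : Type v} {V : Type w} {T : Type z}

/-- The universally quantified variables. -/
def Rule.bodyVars (σ : Rule ar C V) : Set V := conjVars σ.body

/-- The existentially quantified variables. -/
def Rule.exVars (σ : Rule ar C V) : Set V := σ.head.vars \ σ.bodyVars

/-- A Boolean conjunctive query: the existential closure of a conjunction of atoms. -/
abbrev BCQ (ar : P → ℕ) (C : Type v) (V : Type w) := List (Atom ar (RTerm C V))

/-- `I ⊨ q`: there is a homomorphism from the atoms of `q` to the set of facts `I`. -/
def Entails (ι : C → T) (I : Set (Atom ar T)) (q : BCQ ar C V) : Prop :=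
  ∃ θ : V → T, ∀ a ∈ q, a.inst ι θ ∈ I

/-! ### Shy sets of rules -/

/-- `Invaded R ρ y p i`: the position `p[i]` is invaded by the existential variable `y` of the rule
`ρ`. An existential variable is a pair of a rule and a variable name, that is, distinct rules are
regarded as having no variable in common. -/
inductive Invaded (R : Set (Rule ar C V)) (ρ : Rule ar C V) (y : V) :
    (p : P) → Fin (ar p) → Prop
  | exist (hρ : ρ ∈ R) (hy : y ∈ ρ.exVars) (i : Fin (ar ρ.head.pred))
      (hi : ρ.head.args i = .var y) : Invaded R ρ y ρ.head.pred i
  | propagate (σ : Rule ar C V) (hσ : σ ∈ R) (i : Fin (ar σ.head.pred)) (x : V)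
      (hx : x ∈ σ.bodyVars) (hi : σ.head.args i = .var x)
      (hbody : ∀ A ∈ σ.body, ∀ j, A.args j = .var x → Invaded R ρ y A.pred j) :
      Invaded R ρ y σ.head.pred i

/-- The variable `x` is attacked in the body of `σ` by the existential variable `y` of `ρ`:
`x` occurs in the body, and there only at positions invaded by `y`. -/
def Attacked (R : Set (Rule ar C V)) (σ ρ : Rule ar C V) (y x : V) : Prop :=
  x ∈ σ.bodyVars ∧ ∀ A ∈ σ.body, ∀ i, A.args i = .var x → Invaded R ρ y A.pred i

/-- The variable `x` is protected in the body of `σ`: no existential variable attacks it. -/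
def Protected (R : Set (Rule ar C V)) (σ : Rule ar C V) (x : V) : Prop :=
  ∀ (ρ : Rule ar C V) (y : V), ¬ Attacked R σ ρ y x

/-- A set of rules is Shy if in each rule (i) every variable that occurs in more than one body atom
is protected, and (ii) two distinct universal variables that are not protected and occur both in
the head and in two different body atoms are not attacked by the same existential variable. -/
def Shy (R : Set (Rule ar C V)) : Prop :=
  ∀ σ ∈ R,
    (∀ A ∈ σ.body, ∀ B ∈ σ.body, A ≠ B → ∀ x, x ∈ A.vars → x ∈ B.vars → Protected R σ x) ∧
    (∀ A ∈ σ.body, ∀ B ∈ σ.body, A ≠ B →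
      ∀ x₁ x₂, x₁ ≠ x₂ → x₁ ∈ A.vars → x₂ ∈ B.vars → x₁ ∈ σ.head.vars → x₂ ∈ σ.head.vars →
        ¬ Protected R σ x₁ → ¬ Protected R σ x₂ →
          ∀ (ρ : Rule ar C V) (y : V), ¬ (Attacked R σ ρ y x₁ ∧ Attacked R σ ρ y x₂))

end

/-! ### The oblivious chase -/

/-- Terms of the oblivious chase: constants, and labelled nulls. The null `null σ θ y` is the one
created for the existential variable `y` when the rule `σ` fires on the homomorphism `θ` from the
body of `σ`; so different firings create different nulls, and every firing creates new ones. -/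
inductive OTerm {P : Type u} (ar : P → ℕ) (C : Type v) (V : Type w) : Type (max u v w)
  | const (c : C)
  | null (σ : Rule ar C V) (θ : {x // x ∈ σ.bodyVars} → OTerm ar C V) (y : V)

section
variable {P : Type u} {ar : P → ℕ} {C : Type v} {V : Type w}

open Classical in
/-- The extension of a homomorphism `θ` from the body of `σ` by the nulls of this firing. -/
noncomputable def oExtend (σ : Rule ar C V) (θ : V → OTerm ar C V) : V → OTerm ar C V :=
  fun x => if x ∈ σ.bodyVars then θ x else .null σ (fun b => θ b.1) x

/-- Membership in the oblivious chase of the database `D` with the rules `R`: starting from `D`,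
every homomorphism from the body of a rule to the facts obtained so far is fired, once and without
any firing condition. -/
inductive OChaseMem (D : Set (Atom ar C)) (R : Set (Rule ar C V)) :
    Atom ar (OTerm ar C V) → Prop
  | base (a : Atom ar C) (ha : a ∈ D) : OChaseMem D R (a.map .const)
  | fire (σ : Rule ar C V) (hσ : σ ∈ R) (θ : V → OTerm ar C V)
      (hbody : ∀ A ∈ σ.body, OChaseMem D R (A.inst .const θ)) :
      OChaseMem D R (σ.head.inst .const (oExtend σ θ))

/-- The (possibly infinite) oblivious chase of `D` with `R`. -/
def ochase (D : Set (Atom ar C)) (R : Set (Rule ar C V)) : Set (Atom ar (OTerm ar C V)) :=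
  {a | OChaseMem D R a}

end

/-! ### The isomorphic chase, with resumption -/

/-- Terms of the isomorphic chase: constants, labelled nulls, and frozen nulls. Freezing turns a
null into a new constant: `frozen n` is the constant that the null `null n` becomes. -/
inductive ITerm (C : Type v) : Type v
  | const (c : C)
  | frozen (n : ℕ)
  | null (n : ℕ)

/-- Freeze a term: nulls become constants. -/
def ITerm.freeze {C : Type v} : ITerm C → ITerm C
  | .const c => .const c
  | .frozen n => .frozen n
  | .null n => .frozen n

/-- A homomorphism of terms fixes all constants, the frozen nulls among them; it may send a null to
any constant or null. -/
def IsHom {C : Type v} (h : ITerm C → ITerm C) : Prop :=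
  (∀ c, h (.const c) = .const c) ∧ ∀ n, h (.frozen n) = .frozen n

section
variable {P : Type u} {ar : P → ℕ} {C : Type v} {V : Type w}

/-- Isomorphic facts: there is a homomorphism from `{a}` to `{b}` whose inverse is a homomorphism
from `{b}` to `{a}` (the two equations make `g` inverse to `h` on the terms of `a` and `b`). -/
def Isomorphic (a b : Atom ar (ITerm C)) : Prop :=
  ∃ h g : ITerm C → ITerm C, IsHom h ∧ IsHom g ∧ a.map h = b ∧ b.map g = a

/-- The label `n` is new for `I`: neither the null `n` nor its frozen version occurs in `I`. -/
def IsFresh (I : Set (Atom ar (ITerm C))) (n : ℕ) : Prop :=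
  ∀ a ∈ I, ∀ i, a.args i ≠ .null n ∧ a.args i ≠ .frozen n

/-- One step of the isomorphic chase: `θ` maps the body of a rule into `I` and the existential
variables to pairwise distinct new nulls, and the resulting head fact, which must not be isomorphic
to a fact of `I` (the firing condition), is added to `I`. -/
def IStep (R : Set (Rule ar C V)) (I J : Set (Atom ar (ITerm C))) : Prop :=
  ∃ σ ∈ R, ∃ θ : V → ITerm C,
    (∀ A ∈ σ.body, A.inst .const θ ∈ I) ∧
    (∀ y ∈ σ.exVars, ∃ n, θ y = .null n ∧ IsFresh I n) ∧
    Set.InjOn θ σ.exVars ∧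
    (¬ ∃ b ∈ I, Isomorphic (σ.head.inst .const θ) b) ∧
    J = insert (σ.head.inst .const θ) I

/-- `J` is a result of the isomorphic chase of `I`: it is reached from `I` by finitely many steps,
in any order, and no further step is possible. -/
def IsIChase (R : Set (Rule ar C V)) (I J : Set (Atom ar (ITerm C))) : Prop :=
  Relation.ReflTransGen (IStep R) I J ∧ ¬ ∃ K, IStep R J K

/-- `IsIChaseR D R i J`: `J` is a result of the isomorphic chase with resumption `ichase_r(D, R, i)`,
where `ichase_r(D, R, 0) = D`, and `ichase_r(D, R, i + 1)` is the isomorphic chase of the frozen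
`ichase_r(D, R, i)`. -/
inductive IsIChaseR (D : Set (Atom ar C)) (R : Set (Rule ar C V)) :
    ℕ → Set (Atom ar (ITerm C)) → Prop
  | zero : IsIChaseR D R 0 (Atom.map .const '' D)
  | succ (i : ℕ) (I J : Set (Atom ar (ITerm C))) (hI : IsIChaseR D R i I)
      (hJ : IsIChase R (Atom.map ITerm.freeze '' I) J) : IsIChaseR D R (i + 1) J

end

end Chase

namespace Chase

/-! ### Finiteness, fresh labels and instantiation of atoms -/

section General
variable {P C V : Type*} {ar : P → ℕ}

/-! Soundness. Every result of the resumed chase maps homomorphically into the oblivious chase, even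
when frozen labels are read as nulls again: each step is mirrored by the oblivious firing on the
image of its homomorphism (`IStep.exists_map_ochase`).

Termination. Up to isomorphism there are only finitely many facts over finitely many predicates and
constants, and each step adds a new isomorphism type (`exists_isIChase_of_subset`).

Completeness. In the oblivious chase a null sits only at positions invaded by its existential
variable, so a body variable mapped to a null is attacked. Hence images of single facts can be found
separately: by Shy (i) the body atoms of a firing share only values that are constants, so images of
the atoms combine into a homomorphism of the body; the saturated chase then has a fact isomorphic to
the resulting head, and Shy (ii) makes the induced map on the terms of the head well defined. This
is `OChaseMem.mapsInto`.

A query, unlike a rule body, may join on nulls. Resumption handles these: a null whose image has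
been frozen behaves like a constant, so later images of facts can be required to respect its value
(`Prescribes`). Each round fixes at least one further null of the query match, taken minimal in the
argument order, by freezing an image of the fact that created it (`Prescribes.extend`). After as
many rounds as `q` has variables all its nulls are fixed, and one last round maps every atom of `q`
with these common values. -/

theorem Atom.ext_of_args {T : Type*} {p : P} {f g : Fin (ar p) → T} (h : ∀ i, f i = g i) :
    (⟨p, f⟩ : Atom ar T) = ⟨p, g⟩ := by
  rw [funext h]

theorem Atom.vars_finite (a : Atom ar (RTerm C V)) : a.vars.Finite := by
  have h : RTerm.var '' a.vars ⊆ Set.range a.args := by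
    rintro _ ⟨x, ⟨i, hi⟩, rfl⟩
    exact ⟨i, hi⟩
  refine Set.Finite.of_finite_image ((Set.finite_range _).subset h) ?_
  intro x _ y _ hxy
  exact RTerm.var.inj hxy

theorem conjVars_finite (l : List (Atom ar (RTerm C V))) : (conjVars l).Finite := by
  have : conjVars l = ⋃ a ∈ {a | a ∈ l}, a.vars := by
    ext x; simp [conjVars]
  rw [this]
  exact (List.finite_toSet l).biUnion fun a _ => a.vars_finite

theorem Rule.exVars_finite (σ : Rule ar C V) : σ.exVars.Finite :=
  σ.head.vars_finite.subset Set.sdiff_subset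

/-- Terms occurring in a finite set of facts leave infinitely many labels fresh. -/
theorem finite_not_isFresh {I : Set (Atom ar (ITerm C))} (hI : I.Finite) :
    {n | ¬ IsFresh I n}.Finite := by
  have hT : (⋃ a ∈ I, Set.range a.args).Finite :=
    hI.biUnion fun a _ => Set.finite_range _
  have h1 := hT.preimage (f := (ITerm.null : ℕ → ITerm C)) (fun x _ y _ h => by injection h)
  have h2 := hT.preimage (f := (ITerm.frozen : ℕ → ITerm C)) (fun x _ y _ h => by injection h)
  refine (h1.union h2).subset ?_
  intro n hn
  simp only [IsFresh, Set.mem_ofPred_eq, not_forall, not_and_or, not_not] at hn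
  obtain ⟨a, ha, i, h | h⟩ := hn
  · left; simp only [Set.mem_preimage, Set.mem_iUnion]; exact ⟨a, ha, i, h⟩
  · right; simp only [Set.mem_preimage, Set.mem_iUnion]; exact ⟨a, ha, i, h⟩

/-- A finite set of variables can be sent injectively to fresh labels. -/
theorem exists_fresh_labels {I : Set (Atom ar (ITerm C))} (hI : I.Finite) {S : Set V}
    (hS : S.Finite) : ∃ f : V → ℕ, Set.InjOn f S ∧ ∀ y, IsFresh I (f y) := by
  classical
  have hinf : {n | IsFresh I n}.Infinite := by
    intro h
    have := (finite_not_isFresh hI).union h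
    refine Set.infinite_univ (this.subset fun n _ => ?_)
    by_cases hn : IsFresh I n
    · exact Or.inr hn
    · exact Or.inl hn
  obtain ⟨e, he⟩ := Set.countable_iff_exists_injOn.1 hS.countable
  have := hinf.to_subtype
  refine ⟨fun y => Infinite.natEmbedding {n | IsFresh I n} (e y), fun x hx y hy hxy => ?_,
    fun y => (Infinite.natEmbedding {n | IsFresh I n} (e y)).2⟩
  exact he hx hy ((Infinite.natEmbedding _).injective (Subtype.ext hxy))

theorem Atom.map_inst {T T' : Type*} {ι : C → T} {ι' : C → T'} {h : T → T'}
    (hh : ∀ c, h (ι c) = ι' c) {θ : V → T} {θ' : V → T'} (a : Atom ar (RTerm C V))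
    (hθ : ∀ x ∈ a.vars, h (θ x) = θ' x) : (a.inst ι θ).map h = a.inst ι' θ' := by
  refine Atom.ext_of_args fun i => ?_
  show h ((a.args i).eval ι θ) = (a.args i).eval ι' θ'
  cases hi : a.args i with
  | const c => exact hh c
  | var x => exact hθ x ⟨i, hi⟩

theorem IStep.subset {R : Set (Rule ar C V)} {I J : Set (Atom ar (ITerm C))} (h : IStep R I J) :
    I ⊆ J := by
  obtain ⟨σ, _, θ, _, _, _, _, rfl⟩ := h
  exact Set.subset_insert _ _

theorem IStep.finite {R : Set (Rule ar C V)} {I J : Set (Atom ar (ITerm C))} (h : IStep R I J)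
    (hI : I.Finite) : J.Finite := by
  obtain ⟨σ, _, θ, _, _, _, _, rfl⟩ := h
  exact hI.insert _

theorem IsIChase.subset {R : Set (Rule ar C V)} {I J : Set (Atom ar (ITerm C))}
    (h : IsIChase R I J) : I ⊆ J := by
  obtain ⟨h, -⟩ := h
  induction h with
  | refl => exact subset_rfl
  | tail _ hs ih => exact ih.trans hs.subset

theorem IsIChase.finite {R : Set (Rule ar C V)} {I J : Set (Atom ar (ITerm C))}
    (h : IsIChase R I J) (hI : I.Finite) : J.Finite := by
  obtain ⟨h, -⟩ := h
  induction h with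
  | refl => exact hI
  | tail _ hs ih => exact hs.finite ih

theorem IsIChaseR.finite {D : Set (Atom ar C)} {R : Set (Rule ar C V)} (hD : D.Finite) {i : ℕ}
    {J : Set (Atom ar (ITerm C))} (h : IsIChaseR D R i J) : J.Finite := by
  induction h with
  | zero => exact hD.image _
  | succ i I J _ hJ ih => exact hJ.finite (ih.image _)

theorem ITerm.freeze_freeze (t : ITerm C) : t.freeze.freeze = t.freeze := by
  cases t <;> rfl

theorem IsIChaseR.base_subset {D : Set (Atom ar C)} {R : Set (Rule ar C V)} {i : ℕ}
    {J : Set (Atom ar (ITerm C))} (h : IsIChaseR D R i J) :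
    Atom.map .const '' D ⊆ Atom.map ITerm.freeze '' J := by
  have key : ∀ a : Atom ar C, (a.map ITerm.const).map ITerm.freeze = a.map ITerm.const :=
    fun a => rfl
  induction h with
  | zero => rintro _ ⟨a, ha, rfl⟩; exact ⟨_, ⟨a, ha, rfl⟩, key a⟩
  | succ i I J _ hJ ih =>
    rintro _ ⟨a, ha, rfl⟩
    exact ⟨_, hJ.subset (ih ⟨a, ha, rfl⟩), key a⟩

end General

/-! ### Soundness -/

section Soundness
variable {P C V : Type*} {ar : P → ℕ}

/-- The map of terms that reads constants as themselves and labels through `g`, whether they are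
frozen or not. -/
def readLabels {T : Type*} (ι : C → T) (g : ℕ → T) : ITerm C → T
  | .const c => ι c
  | .frozen n => g n
  | .null n => g n

/-- The oblivious chase has no firing condition, so the same rule fires there on the image of `θ`.
Sending the new labels to the nulls of that firing extends `g`. -/
theorem IStep.exists_map_ochase {D : Set (Atom ar C)} {R : Set (Rule ar C V)}
    {I J : Set (Atom ar (ITerm C))} (h : IStep R I J) {g : ℕ → OTerm ar C V}
    (hg : ∀ a ∈ I, a.map (readLabels .const g) ∈ ochase D R) :
    ∃ g' : ℕ → OTerm ar C V, ∀ a ∈ J, a.map (readLabels .const g') ∈ ochase D R := by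
  classical
  obtain ⟨σ, hσ, θ, hbody, hfresh, hinj, -, rfl⟩ := h
  set η : V → OTerm ar C V := fun x => readLabels .const g (θ x)
  -- The chosen `y` is unique, since `θ` is injective on the existential variables.
  let g' : ℕ → OTerm ar C V := fun n =>
    if h : ∃ y ∈ σ.exVars, θ y = .null n then oExtend σ η h.choose else g n
  -- New labels occur in `I` neither as nulls nor frozen, so redefining them leaves the old facts
  -- alone.
  have hold : ∀ a ∈ I, ∀ i, readLabels .const g' (a.args i) = readLabels .const g (a.args i) := by
    intro a ha i
    have aux : ∀ n, (a.args i = .null n ∨ a.args i = .frozen n) → g' n = g n := by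
      intro n hn
      refine dif_neg ?_
      rintro ⟨y, hy, hyn⟩
      obtain ⟨m, hm, hfr⟩ := hfresh y hy
      rw [hyn] at hm
      injection hm with hm
      subst hm
      rcases hn with hn | hn
      · exact (hfr a ha i).1 hn
      · exact (hfr a ha i).2 hn
    cases hi : a.args i with
    | const c => rfl
    | frozen n => exact aux n (Or.inr hi)
    | null n => exact aux n (Or.inl hi)
  refine ⟨g', fun a ha => ?_⟩
  rcases ha with rfl | ha
  · have hmem : OChaseMem D R (σ.head.inst .const (oExtend σ η)) := by
      refine OChaseMem.fire σ hσ η fun A hA => ?_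
      have := hg _ (hbody A hA)
      rwa [Atom.map_inst (ι := ITerm.const) (ι' := OTerm.const) (θ' := η) (fun c => rfl) A (fun x _ => rfl)] at this
    rw [Atom.map_inst (ι := ITerm.const) (ι' := OTerm.const) (θ' := oExtend σ η) (fun c => rfl)]
    · exact hmem
    · intro x hx
      by_cases hxb : x ∈ σ.bodyVars
      · rw [oExtend, if_pos hxb]
        obtain ⟨A, hA, i, hi⟩ := hxb
        have := hold _ (hbody A hA) i
        simpa [Atom.inst, hi, RTerm.eval] using this
      · obtain ⟨n, hn, -⟩ := hfresh x ⟨hx, hxb⟩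
        have hex : ∃ y ∈ σ.exVars, θ y = .null n := ⟨x, ⟨hx, hxb⟩, hn⟩
        rw [hn]
        show g' n = _
        have : g' n = oExtend σ η hex.choose := dif_pos hex
        rw [this, hinj hex.choose_spec.1 ⟨hx, hxb⟩ (hex.choose_spec.2.trans hn.symm)]
  · have : a.map (readLabels .const g') = a.map (readLabels .const g) :=
      Atom.ext_of_args (hold a ha)
    rw [this]
    exact hg a ha

/-- A label is read in the same way before and after freezing, so one map survives the passage from
round to round. -/
theorem IsIChaseR.exists_map_ochase {D : Set (Atom ar C)} {R : Set (Rule ar C V)} [Nonempty C]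
    {i : ℕ} {J : Set (Atom ar (ITerm C))} (h : IsIChaseR D R i J) :
    ∃ g : ℕ → OTerm ar C V, ∀ a ∈ J, a.map (readLabels .const g) ∈ ochase D R := by
  induction h with
  | zero =>
    -- No label occurs in `D`, so any default value serves.
    refine ⟨fun _ => .const (Classical.arbitrary C), ?_⟩
    rintro _ ⟨a, ha, rfl⟩
    exact OChaseMem.base a ha
  | succ i I J _ hJ ih =>
    obtain ⟨hJ, -⟩ := hJ
    induction hJ with
    | refl =>
      obtain ⟨g, hg⟩ := ih
      refine ⟨g, ?_⟩
      rintro _ ⟨a, ha, rfl⟩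
      have : (a.map ITerm.freeze).map (readLabels .const g) = a.map (readLabels .const g) := by
        refine Atom.ext_of_args fun i => ?_
        show readLabels _ g (a.args i).freeze = readLabels _ g (a.args i)
        cases a.args i <;> rfl
      rw [this]
      exact hg a ha
    | tail _ hs ih' =>
      obtain ⟨g, hg⟩ := ih'
      exact hs.exists_map_ochase hg

theorem IsIChaseR.entails_ochase {D : Set (Atom ar C)} {R : Set (Rule ar C V)} [Nonempty C]
    {i : ℕ} {J : Set (Atom ar (ITerm C))} (h : IsIChaseR D R i J) {q : BCQ ar C V}
    (hq : Entails ITerm.const J q) : Entails OTerm.const (ochase D R) q := by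
  obtain ⟨g, hg⟩ := h.exists_map_ochase
  obtain ⟨θ, hθ⟩ := hq
  refine ⟨fun x => readLabels .const g (θ x), fun a ha => ?_⟩
  have := hg _ (hθ a ha)
  rwa [Atom.map_inst (ι := ITerm.const) (ι' := OTerm.const) (θ' := fun x => readLabels .const g (θ x))
    (fun c => rfl) a (fun x _ => rfl)] at this

end Soundness

/-! ### Termination -/

section Termination
variable {P C V : Type*} {ar : P → ℕ}

/-- The first position of the null `n` in the fact `a`. -/
noncomputable def Atom.firstPos (a : Atom ar (ITerm C)) (n : ℕ) : ℕ :=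
  sInf {k | ∃ h : k < ar a.pred, a.args ⟨k, h⟩ = .null n}

theorem Atom.firstPos_spec (a : Atom ar (ITerm C)) {n : ℕ} {i : Fin (ar a.pred)}
    (hi : a.args i = .null n) :
    ∃ h : a.firstPos n < ar a.pred, a.args ⟨a.firstPos n, h⟩ = .null n :=
  Nat.sInf_mem (s := {k | ∃ h : k < ar a.pred, a.args ⟨k, h⟩ = .null n}) ⟨i, i.2, hi⟩

/-- Replace the nulls, keeping the constants and the frozen nulls. -/
def ITerm.substNulls (f : ℕ → ITerm C) : ITerm C → ITerm C
  | .const c => .const c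
  | .frozen n => .frozen n
  | .null n => f n

/-- Rename each null of a fact to its first position. -/
noncomputable def Atom.canon (a : Atom ar (ITerm C)) : Atom ar (ITerm C) :=
  a.map (ITerm.substNulls fun n => .null (a.firstPos n))

/-- Send a null of `a` to the argument of `b` at the first position of that null. Equal canonical
forms make this position also the first one of the corresponding null of `b`. -/
theorem Atom.exists_hom_of_canon_eq {a b : Atom ar (ITerm C)} (h : a.canon = b.canon) :
    ∃ f, IsHom f ∧ a.map f = b := by
  classical
  obtain ⟨p, s⟩ := a
  obtain ⟨p', t⟩ := b
  have hp : p = p' := congrArg Atom.pred h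
  subst hp
  have harg : ∀ i, (s i).substNulls (fun n => .null (firstPos ⟨p, s⟩ n)) =
      (t i).substNulls (fun n => .null (firstPos ⟨p, t⟩ n)) := by
    simp only [Atom.canon, Atom.map, Atom.mk.injEq, heq_eq_eq, true_and] at h
    exact congrFun h
  refine ⟨ITerm.substNulls fun n =>
    if h : firstPos ⟨p, s⟩ n < ar p then t ⟨_, h⟩ else .null n, ⟨fun _ => rfl, fun _ => rfl⟩,
    Atom.ext_of_args fun i => ?_⟩
  have hi := harg i
  show (s i).substNulls _ = t i
  cases hs : s i <;> cases ht : t i <;> rw [hs, ht] at hi <;>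
    simp only [ITerm.substNulls, ITerm.const.injEq, ITerm.frozen.injEq, ITerm.null.injEq,
      reduceCtorEq] at hi ⊢
  · exact hi
  · exact hi
  · obtain ⟨h1, -⟩ := firstPos_spec ⟨p, s⟩ (i := i) hs
    obtain ⟨h2, h2'⟩ := firstPos_spec ⟨p, t⟩ (i := i) ht
    rw [dif_pos h1, ← h2']
    congr 2

theorem Atom.isomorphic_of_canon_eq {a b : Atom ar (ITerm C)} (h : a.canon = b.canon) :
    Isomorphic a b := by
  obtain ⟨f, hf, hfab⟩ := exists_hom_of_canon_eq h
  obtain ⟨g, hg, hgab⟩ := exists_hom_of_canon_eq h.symm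
  exact ⟨f, g, hf, hg, hfab, hgab⟩

/-- The facts with predicates from `Q` whose arguments are nulls or from `K`. -/
def factsOver (ar : P → ℕ) (Q : Set P) (K : Set (ITerm C)) : Set (Atom ar (ITerm C)) :=
  {a | a.pred ∈ Q ∧ ∀ i, a.args i ∈ K ∨ ∃ n, a.args i = .null n}

theorem finite_canon_factsOver {Q : Set P} {K : Set (ITerm C)} (hQ : Q.Finite) (hK : K.Finite) :
    (Atom.canon '' factsOver ar Q K).Finite := by
  have : (⋃ p ∈ Q, (fun f => (⟨p, f⟩ : Atom ar (ITerm C))) ''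
      Set.univ.pi fun _ => K ∪ ITerm.null '' Set.Iio (ar p)).Finite := by
    refine hQ.biUnion fun p _ => Set.Finite.image _ (Set.Finite.pi fun _ => ?_)
    exact hK.union ((Set.finite_Iio _).image _)
  refine this.subset ?_
  rintro _ ⟨a, ⟨hp, ha⟩, rfl⟩
  simp only [Set.mem_iUnion]
  refine ⟨a.pred, hp, _, ?_, rfl⟩
  intro i _
  cases hi : a.args i with
  | const c =>
    left
    rcases ha i with h | ⟨n, h⟩
    · simpa [hi, ITerm.substNulls] using h
    · simp [hi] at h
  | frozen c =>
    left
    rcases ha i with h | ⟨n, h⟩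
    · simpa [hi, ITerm.substNulls] using h
    · simp [hi] at h
  | null n =>
    right
    exact ⟨_, (a.firstPos_spec hi).1, by simp [hi, ITerm.substNulls]⟩

/-- `factsOver ar Q K` is closed under steps and has finitely many canonical forms. The number of
forms not yet represented drops with every step. -/
theorem exists_isIChase_of_subset {R : Set (Rule ar C V)} {Q : Set P} {K : Set (ITerm C)}
    (hQ : Q.Finite) (hK : K.Finite) (hRQ : ∀ σ ∈ R, σ.head.pred ∈ Q)
    (hRK : ∀ σ ∈ R, ∀ i c, σ.head.args i = .const c → ITerm.const c ∈ K)
    {I : Set (Atom ar (ITerm C))} (hI : I ⊆ factsOver ar Q K) : ∃ J, IsIChase R I J := by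
  induction hm : (Atom.canon '' factsOver ar Q K \ Atom.canon '' I).ncard using
    Nat.strong_induction_on generalizing I with
  | _ m ih =>
  by_cases hs : ∃ L, IStep R I L
  swap
  · exact ⟨I, .refl, hs⟩
  obtain ⟨L, hL⟩ := hs
  obtain ⟨σ, hσ, θ, hbody, hfresh, -, hiso, rfl⟩ := id hL
  have hnew : σ.head.inst .const θ ∈ factsOver ar Q K := by
    refine ⟨hRQ σ hσ, fun i => ?_⟩
    show (σ.head.args i).eval _ _ ∈ K ∨ ∃ n, (σ.head.args i).eval _ _ = _
    cases hi : σ.head.args i with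
    | const c => exact Or.inl (hRK σ hσ i c hi)
    | var x =>
      by_cases hx : x ∈ σ.bodyVars
      · obtain ⟨A, hA, j, hj⟩ := hx
        have := (hI (hbody A hA)).2 j
        simpa [Atom.inst, hj, RTerm.eval] using this
      · obtain ⟨n, hn, -⟩ := hfresh x ⟨⟨i, hi⟩, hx⟩
        exact Or.inr ⟨n, hn⟩
  -- A fact of `I` with the canonical form of the new head would be isomorphic to it, against the
  -- firing condition.
  have hlt : (Atom.canon '' factsOver ar Q K \
      Atom.canon '' (insert (σ.head.inst .const θ) I)).ncard < m := by
    rw [← hm]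
    refine Set.ncard_lt_ncard ?_ (((finite_canon_factsOver hQ hK)).subset Set.sdiff_subset)
    refine (Set.ssubset_iff_of_subset
      (Set.sdiff_subset_sdiff_right (Set.image_mono (Set.subset_insert _ _)))).2
      ⟨(σ.head.inst .const θ).canon, ⟨⟨_, hnew, rfl⟩, ?_⟩, ?_⟩
    · rintro ⟨b, hb, hbe⟩
      exact hiso ⟨b, hb, Atom.isomorphic_of_canon_eq hbe.symm⟩
    · intro h
      exact h.2 ⟨_, Set.mem_insert _ _, rfl⟩
  obtain ⟨J, hJ, hJ'⟩ := ih _ hlt (Set.insert_subset hnew hI) rfl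
  exact ⟨J, hJ.head hL, hJ'⟩

theorem exists_isIChase {R : Set (Rule ar C V)} (hR : R.Finite) {I : Set (Atom ar (ITerm C))}
    (hI : I.Finite) : ∃ J, IsIChase R I J := by
  -- Only the constants of the heads matter in `K`; variables are read as the dummy `.null 0`, which
  -- is harmless there.
  refine exists_isIChase_of_subset (Q := Atom.pred '' I ∪ (fun σ => σ.head.pred) '' R)
    (K := (⋃ a ∈ I, Set.range a.args) ∪
      ⋃ σ ∈ R, Set.range fun i => (σ.head.args i).eval ITerm.const fun _ => .null 0)
    ((hI.image _).union (hR.image _))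
    ((hI.biUnion fun a _ => Set.finite_range _).union
      (hR.biUnion fun σ _ => Set.finite_range _)) ?_ ?_ ?_
  · exact fun σ hσ => Or.inr ⟨σ, hσ, rfl⟩
  · intro σ hσ i c hi
    right
    simp only [Set.mem_iUnion]
    exact ⟨σ, hσ, i, by simp [hi, RTerm.eval]⟩
  · refine fun a ha => ⟨Or.inl ⟨a, ha, rfl⟩, fun i => Or.inl (Or.inl ?_)⟩
    simp only [Set.mem_iUnion]
    exact ⟨a, ha, i, rfl⟩

theorem exists_isIChaseR {D : Set (Atom ar C)} {R : Set (Rule ar C V)} (hD : D.Finite)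
    (hR : R.Finite) (i : ℕ) : ∃ J, IsIChaseR D R i J := by
  induction i with
  | zero => exact ⟨_, .zero⟩
  | succ i ih =>
    obtain ⟨I, hI⟩ := ih
    obtain ⟨J, hJ⟩ := exists_isIChase hR ((hI.finite hD).image (Atom.map ITerm.freeze))
    exact ⟨J, .succ i I J hI hJ⟩

end Termination

/-! ### Completeness -/

section Completeness
variable {P C V : Type*} {ar : P → ℕ}

/-- In the oblivious chase a null occurs only at positions invaded by its existential variable. -/
theorem OChaseMem.invaded {D : Set (Atom ar C)} {R : Set (Rule ar C V)}
    {a : Atom ar (OTerm ar C V)} (h : OChaseMem D R a) {i : Fin (ar a.pred)} {ρ : Rule ar C V}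
    {η : {x // x ∈ ρ.bodyVars} → OTerm ar C V} {y : V} (hi : a.args i = .null ρ η y) :
    Invaded R ρ y a.pred i := by
  induction h with
  | base a ha => simp [Atom.map] at hi
  | fire σ hσ θ hbody ih =>
    change (σ.head.args i).eval OTerm.const (oExtend σ θ) = _ at hi
    cases hx : σ.head.args i with
    | const c => simp [hx, RTerm.eval] at hi
    | var x =>
      rw [hx] at hi
      change oExtend σ θ x = _ at hi
      by_cases hxb : x ∈ σ.bodyVars
      · rw [oExtend, if_pos hxb] at hi
        refine Invaded.propagate σ hσ i x hxb hx fun A hA j hj => ih A hA (i := j) ?_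
        show (A.args j).eval OTerm.const θ = _
        rw [hj]
        exact hi
      · rw [oExtend, if_neg hxb] at hi
        injection hi with h1 h2 h3
        subst h1 h3
        exact Invaded.exist hσ ⟨⟨i, hx⟩, hxb⟩ i hx

/-- A body variable that is mapped to a null is attacked by the existential variable of the null. -/
theorem attacked_of_eq_null {D : Set (Atom ar C)} {R : Set (Rule ar C V)} {σ : Rule ar C V}
    {θ : V → OTerm ar C V} (hbody : ∀ A ∈ σ.body, OChaseMem D R (A.inst .const θ)) {x : V}
    (hx : x ∈ σ.bodyVars) {ρ : Rule ar C V} {η : {x // x ∈ ρ.bodyVars} → OTerm ar C V} {y : V}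
    (h : θ x = .null ρ η y) : Attacked R σ ρ y x := by
  refine ⟨hx, fun A hA i hi => (hbody A hA).invaded (i := i) (η := η) ?_⟩
  show (A.args i).eval OTerm.const θ = _
  rw [hi]
  exact h

/-- The head fact of the firing of `σ` on the homomorphism `η` from its body. -/
noncomputable def firedHead (σ : Rule ar C V) (η : {x // x ∈ σ.bodyVars} → OTerm ar C V) :
    Atom ar (OTerm ar C V) := by
  classical
  exact σ.head.inst .const fun x => if h : x ∈ σ.bodyVars then η ⟨x, h⟩ else .null σ η x

/-- The fact added by a firing depends on `θ` only through its restriction to the body variables,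
which is stored in each created null; the fact can thus be recovered from the null. -/
theorem inst_oExtend (σ : Rule ar C V) (θ : V → OTerm ar C V) :
    σ.head.inst .const (oExtend σ θ) = firedHead σ fun b => θ b.1 := by
  have : oExtend σ θ = fun x => by
      classical exact if h : x ∈ σ.bodyVars then θ x else .null σ (fun b => θ b.1) x := by
    funext x
    by_cases h : x ∈ σ.bodyVars <;> simp [oExtend, h]
  rw [this]
  rfl

/-- A null in a head either was created by that firing or already occurs in its body, so tracing it
back leads to the firing that created it. -/
theorem OChaseMem.firedHead_mem {D : Set (Atom ar C)} {R : Set (Rule ar C V)}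
    {a : Atom ar (OTerm ar C V)} (h : OChaseMem D R a) {i : Fin (ar a.pred)} {ρ : Rule ar C V}
    {η : {x // x ∈ ρ.bodyVars} → OTerm ar C V} {y : V} (hi : a.args i = .null ρ η y) :
    OChaseMem D R (firedHead ρ η) := by
  induction h with
  | base a ha => simp [Atom.map] at hi
  | fire σ hσ θ hbody ih =>
    change (σ.head.args i).eval OTerm.const (oExtend σ θ) = _ at hi
    cases hx : σ.head.args i with
    | const c => simp [hx, RTerm.eval] at hi
    | var x =>
      rw [hx] at hi
      change oExtend σ θ x = _ at hi
      by_cases hxb : x ∈ σ.bodyVars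
      · rw [oExtend, if_pos hxb] at hi
        obtain ⟨A, hA, j, hj⟩ := id hxb
        refine ih A hA (i := j) ?_
        show (A.args j).eval OTerm.const θ = _
        rw [hj]
        exact hi
      · rw [oExtend, if_neg hxb] at hi
        injection hi with h1 h2 h3
        subst h1
        obtain rfl := eq_of_heq h2
        rw [← inst_oExtend]
        exact OChaseMem.fire σ hσ θ hbody

/-- `t` is a term of the firing that creates the null `n`: a value of its homomorphism, or a null
created by it. -/
inductive OTerm.InFiring : OTerm ar C V → OTerm ar C V → Prop
  | value (σ : Rule ar C V) (η : {x // x ∈ σ.bodyVars} → OTerm ar C V) (y : V) (b) :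
      InFiring (η b) (.null σ η y)
  | created (σ : Rule ar C V) (η : {x // x ∈ σ.bodyVars} → OTerm ar C V) (y y' : V) :
      InFiring (.null σ η y') (.null σ η y)

/-- `t` is an argument of the term `n`. -/
inductive OTerm.Sub : OTerm ar C V → OTerm ar C V → Prop
  | mk (σ : Rule ar C V) (η : {x // x ∈ σ.bodyVars} → OTerm ar C V) (y : V) (b) :
      Sub (η b) (.null σ η y)

theorem OTerm.wellFounded_sub : WellFounded (OTerm.Sub (ar := ar) (C := C) (V := V)) := by
  refine ⟨fun t => ?_⟩
  induction t with
  | const c => exact ⟨_, fun s hs => by cases hs⟩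
  | null σ η y ih => exact ⟨_, fun s hs => by cases hs; exact ih _⟩

theorem OTerm.ne_null_self (σ : Rule ar C V) (η : {x // x ∈ σ.bodyVars} → OTerm ar C V) (y : V)
    (b) : η b ≠ .null σ η y := by
  intro h
  refine OTerm.wellFounded_sub.irrefl.irrefl (η b) ?_
  nth_rw 2 [h]
  exact .mk σ η y b

theorem firedHead_args (σ : Rule ar C V) (η : {x // x ∈ σ.bodyVars} → OTerm ar C V) (y : V)
    (i : Fin (ar (firedHead σ η).pred)) :
    (∃ c, (firedHead σ η).args i = .const c) ∨
      ((firedHead σ η).args i).InFiring (.null σ η y) := by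
  classical
  change (∃ c, (σ.head.args i).eval _ _ = _) ∨ OTerm.InFiring ((σ.head.args i).eval _ _) _
  cases hx : σ.head.args i with
  | const c => exact Or.inl ⟨c, rfl⟩
  | var x =>
    right
    simp only [RTerm.eval]
    split_ifs with h
    · exact .value ..
    · exact .created ..

/-! ### Images of facts with prescribed values of nulls -/

/-- The fact `a` has a homomorphic image in `I` under a map that agrees with `π` on `N`. -/
def MapsInto (N : Set (OTerm ar C V)) (π : OTerm ar C V → ITerm C) (I : Set (Atom ar (ITerm C)))
    (a : Atom ar (OTerm ar C V)) : Prop :=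
  ∃ h : OTerm ar C V → ITerm C, (∀ c, h (.const c) = .const c) ∧
    (∀ i, a.args i ∈ N → h (a.args i) = π (a.args i)) ∧ a.map h ∈ I

/-- `π` sends the terms in `N` to constants, in such a way that for each null in `N` the fact in
which it was created maps into `I`. -/
structure Prescribes (I : Set (Atom ar (ITerm C))) (N : Set (OTerm ar C V))
    (π : OTerm ar C V → ITerm C) : Prop where
  const : ∀ c, π (.const c) = .const c
  freeze : ∀ t ∈ N, (π t).freeze = π t
  created : ∀ σ η y, OTerm.null σ η y ∈ N → MapsInto N π I (firedHead σ η)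

theorem IsHom.apply_of_freeze {g : ITerm C → ITerm C} (hg : IsHom g) {t : ITerm C}
    (ht : t.freeze = t) : g t = t := by
  cases t with
  | const c => exact hg.1 c
  | frozen n => exact hg.2 n
  | null n => simp [ITerm.freeze] at ht

/-- The isomorphic chase of `I` contains a homomorphic image of each fact of the oblivious chase,
with the prescribed values of nulls. -/
theorem OChaseMem.mapsInto {D : Set (Atom ar C)} {R : Set (Rule ar C V)} (hShy : Shy R)
    {I J : Set (Atom ar (ITerm C))} (hIJ : I ⊆ J) (hJ : ¬ ∃ K, IStep R J K) (hfin : J.Finite)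
    (hD : Atom.map .const '' D ⊆ I) {N : Set (OTerm ar C V)} {π : OTerm ar C V → ITerm C}
    (hπ : Prescribes I N π) {a : Atom ar (OTerm ar C V)} (ha : OChaseMem D R a) :
    MapsInto N π J a := by
  classical
  induction ha with
  | base a ha => exact ⟨π, hπ.const, fun i _ => rfl, hIJ (hD ⟨a, ha, by
      exact Atom.ext_of_args fun i => (hπ.const _).symm⟩)⟩
  | fire σ hσ θ hbody ih =>
    -- If the firing creates a null in `N`, the prescription already provides an image of its head.
    by_cases hex : ∃ y ∈ σ.exVars, OTerm.null σ (fun b => θ b.1) y ∈ N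
    · obtain ⟨y, -, hy⟩ := hex
      obtain ⟨h, h1, h2, h3⟩ := hπ.created _ _ _ hy
      rw [inst_oExtend]
      exact ⟨h, h1, h2, hIJ h3⟩
    push Not at hex
    have : Nonempty (ITerm C) := ⟨.null 0⟩
    choose! h hc hN hmem using ih
    have hatom : ∀ x, ∃ A, x ∈ σ.bodyVars → A ∈ σ.body ∧ x ∈ A.vars := by
      intro x
      by_cases hx : x ∈ σ.bodyVars
      · obtain ⟨A, hA⟩ := id hx
        exact ⟨A, fun _ => hA⟩
      · exact ⟨σ.head, fun h => absurd h hx⟩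
    choose at' hat using hatom
    obtain ⟨f, hf, hfr⟩ := exists_fresh_labels hfin σ.exVars_finite
    let θ' : V → ITerm C := fun x => if x ∈ σ.bodyVars then h (at' x) (θ x) else .null (f x)
    -- Each body atom `A` has its own map `h A`. A variable in two atoms is protected by Shy (i), so
    -- its value is a constant, on which all these maps agree.
    have hjoin : ∀ A ∈ σ.body, ∀ x ∈ A.vars, h A (θ x) = θ' x := by
      intro A hA x hx
      have hxb : x ∈ σ.bodyVars := ⟨A, hA, hx⟩
      simp only [θ', if_pos hxb]
      obtain ⟨hB, hxB⟩ := hat x hxb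
      by_cases hAB : A = at' x
      · rw [← hAB]
      · cases ht : θ x with
        | const c => rw [hc A hA, hc _ hB]
        | null ρ η y =>
          exact absurd (attacked_of_eq_null hbody hxb ht)
            ((hShy σ hσ).1 A hA _ hB hAB x hx hxB ρ y)
    have hbody' : ∀ A ∈ σ.body, A.inst .const θ' ∈ J := by
      intro A hA
      rw [← Atom.map_inst (ι := OTerm.const) (θ := θ) (hc A hA) A (hjoin A hA)]
      exact hmem A hA
    have hθ'ex : ∀ y ∈ σ.exVars, θ' y = .null (f y) := fun y hy => if_neg hy.2
    -- Otherwise `σ` could still fire on `θ'`, although `J` is saturated.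
    obtain ⟨b, hb, g, -, hg, -, hgb, -⟩ : ∃ b ∈ J, Isomorphic (σ.head.inst .const θ') b := by
      by_contra hno
      refine hJ ⟨_, σ, hσ, θ', hbody', fun y hy => ⟨f y, hθ'ex y hy, hfr y⟩, ?_, hno, rfl⟩
      intro x hx y hy hxy
      rw [hθ'ex x hx, hθ'ex y hy] at hxy
      injection hxy with hxy
      exact hf hx hy hxy
    -- A null shared by two distinct body variables makes its existential variable attack both; Shy
    -- (ii) excludes this unless their chosen atoms coincide, and then a single map `h` is involved.
    -- Created nulls are distinct from one another and from the values of `θ`.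
    have hwell : ∀ x₁ ∈ σ.head.vars, ∀ x₂ ∈ σ.head.vars,
        oExtend σ θ x₁ = oExtend σ θ x₂ → g (θ' x₁) = g (θ' x₂) := by
      intro x₁ hx₁ x₂ hx₂ he
      by_cases hxe : x₁ = x₂
      · rw [hxe]
      by_cases hb₁ : x₁ ∈ σ.bodyVars <;> by_cases hb₂ : x₂ ∈ σ.bodyVars
      · simp only [oExtend, if_pos hb₁, if_pos hb₂] at he
        obtain ⟨hA₁, hv₁⟩ := hat x₁ hb₁
        obtain ⟨hA₂, hv₂⟩ := hat x₂ hb₂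
        simp only [θ', if_pos hb₁, if_pos hb₂]
        by_cases hA : at' x₁ = at' x₂
        · rw [hA, he]
        · cases ht : θ x₁ with
          | const c => rw [← he, ht, hc _ hA₁, hc _ hA₂]
          | null ρ η y =>
            have t₁ := attacked_of_eq_null hbody hb₁ ht
            have t₂ := attacked_of_eq_null hbody hb₂ (he ▸ ht)
            exact absurd ⟨t₁, t₂⟩ ((hShy σ hσ).2 _ hA₁ _ hA₂ hA x₁ x₂ hxe hv₁ hv₂ hx₁ hx₂
              (fun hp => hp ρ y t₁) (fun hp => hp ρ y t₂) ρ y)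
      · simp only [oExtend, if_pos hb₁, if_neg hb₂] at he
        exact absurd he (OTerm.ne_null_self σ (fun b => θ b.1) x₂ ⟨x₁, hb₁⟩)
      · simp only [oExtend, if_neg hb₁, if_pos hb₂] at he
        exact absurd he.symm (OTerm.ne_null_self σ (fun b => θ b.1) x₁ ⟨x₂, hb₂⟩)
      · simp only [oExtend, if_neg hb₁, if_neg hb₂] at he
        injection he with _ _ he
        exact absurd he hxe
    have hconst : ∀ x ∈ σ.head.vars, ∀ c, oExtend σ θ x = .const c → g (θ' x) = .const c := by
      intro x hx c he
      by_cases hxb : x ∈ σ.bodyVars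
      · simp only [oExtend, if_pos hxb] at he
        simp only [θ', if_pos hxb, he]
        rw [hc _ (hat x hxb).1, hg.1]
      · simp [oExtend, if_neg hxb] at he
    let k : OTerm ar C V → ITerm C := fun t => match t with
      | .const c => .const c
      | t => if hx : ∃ x ∈ σ.head.vars, oExtend σ θ x = t then g (θ' hx.choose) else π t
    have hk : ∀ x ∈ σ.head.vars, k (oExtend σ θ x) = g (θ' x) := by
      intro x hx
      cases ht : oExtend σ θ x with
      | const c => exact (hconst x hx c ht).symm
      | null ρ η y =>
        have hx' : ∃ x ∈ σ.head.vars, oExtend σ θ x = .null ρ η y := ⟨x, hx, ht⟩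
        show (if hx : ∃ x ∈ σ.head.vars, oExtend σ θ x = .null ρ η y
          then g (θ' hx.choose) else _) = _
        rw [dif_pos hx']
        exact hwell _ hx'.choose_spec.1 _ hx (hx'.choose_spec.2.trans ht.symm)
    refine ⟨k, fun c => rfl, ?_, ?_⟩
    · intro i
      show (σ.head.args i).eval _ _ ∈ N → k ((σ.head.args i).eval _ _) = π ((σ.head.args i).eval _ _)
      cases hx : σ.head.args i with
      | const c => exact fun _ => (hπ.const c).symm
      | var x =>
        intro hxN
        change oExtend σ θ x ∈ N at hxN
        change k (oExtend σ θ x) = π (oExtend σ θ x)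
        rw [hk x ⟨i, hx⟩]
        by_cases hxb : x ∈ σ.bodyVars
        · have hfz := hπ.freeze _ hxN
          simp only [oExtend, if_pos hxb] at hxN hfz ⊢
          simp only [θ', if_pos hxb]
          obtain ⟨hA, j, hj⟩ := hat x hxb
          have := hN _ hA j
          simp only [Atom.inst, hj, RTerm.eval] at this
          -- Prescribed values contain no null, so the isomorphism `g` cannot move them.
          rw [this hxN, hg.apply_of_freeze hfz]
        · simp only [oExtend, if_neg hxb] at hxN
          exact absurd hxN (hex x ⟨⟨i, hx⟩, hxb⟩)
    · rw [Atom.map_inst (ι := OTerm.const) (ι' := ITerm.const) (θ' := fun x => g (θ' x))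
        (fun c => rfl) σ.head hk]
      rw [Atom.map_inst (ι' := ITerm.const) (θ' := fun x => g (θ' x)) hg.1 σ.head
        (fun _ _ => rfl)] at hgb
      rw [hgb]
      exact hb

/-- Freezing a map into `J` extends the prescription to further nulls of the firing. -/
theorem Prescribes.extend {I J : Set (Atom ar (ITerm C))} {N T : Set (OTerm ar C V)}
    {π : OTerm ar C V → ITerm C} (hπ : Prescribes I N π) (hIJ : I ⊆ Atom.map ITerm.freeze '' J)
    (hNT : ∀ n ∈ N, ∀ m ∈ T, m.InFiring n → m ∈ N) {σ : Rule ar C V}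
    {η : {x // x ∈ σ.bodyVars} → OTerm ar C V} (h : MapsInto N π J (firedHead σ η)) :
    ∃ π', Prescribes (Atom.map ITerm.freeze '' J) (N ∪ (T ∩ Set.range (OTerm.null σ η))) π' := by
  classical
  obtain ⟨h, hc, hN, hmem⟩ := h
  set G := T ∩ Set.range (OTerm.null σ η)
  let π' : OTerm ar C V → ITerm C := fun t => if t ∈ N then π t else
    if t ∈ G then (h t).freeze else π t
  have hπN : ∀ t ∈ N, π' t = π t := fun t ht => if_pos ht
  have hπG : ∀ t ∉ N, t ∈ G → π' t = (h t).freeze := fun t h1 h2 => by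
    simp only [π', if_neg h1, if_pos h2]
  refine ⟨π', ⟨fun c => ?_, ?_, ?_⟩⟩
  · have : OTerm.const c ∉ G := by rintro ⟨-, y, hy⟩; cases hy
    simp only [π', if_neg this, ite_self]
    exact hπ.const c
  · rintro t ht
    by_cases htN : t ∈ N
    · rw [hπN t htN]; exact hπ.freeze t htN
    · rw [hπG t htN (ht.resolve_left htN), ITerm.freeze_freeze]
  · intro ρ ζ y hy
    by_cases hyN : OTerm.null ρ ζ y ∈ N
    · obtain ⟨h', hc', hN', hmem'⟩ := hπ.created ρ ζ y hyN
      refine ⟨h', hc', fun i hi => ?_, hIJ hmem'⟩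
      -- The closure of `N` under `InFiring` within `T` means that none of the newly prescribed
      -- nulls occurs in this older fact, so its image stays valid for `π'`.
      have hiN : (firedHead ρ ζ).args i ∈ N := by
        rcases hi with hi | hi
        · exact hi
        · rcases firedHead_args ρ ζ y i with ⟨c, hcst⟩ | hF
          · rw [hcst] at hi
            obtain ⟨-, z, hz⟩ := hi
            cases hz
          · exact hNT _ hyN _ hi.1 hF
      rw [hN' i hiN, hπN _ hiN]
    · obtain ⟨-, z, hz⟩ := hy.resolve_left hyN
      injection hz with h1 h2 h3
      subst h1
      obtain rfl := eq_of_heq h2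
      refine ⟨fun t => (h t).freeze, fun c => by simp only [hc]; rfl, fun i hi => ?_,
        _, hmem, rfl⟩
      by_cases hiN : (firedHead σ η).args i ∈ N
      · simp only [hπN _ hiN, hN i hiN, hπ.freeze _ hiN]
      · rw [hπG _ hiN (hi.resolve_left hiN)]

theorem Prescribes.mono {I J : Set (Atom ar (ITerm C))} {N : Set (OTerm ar C V)}
    {π : OTerm ar C V → ITerm C} (hπ : Prescribes I N π) (hIJ : I ⊆ J) : Prescribes J N π where
  const := hπ.const
  freeze := hπ.freeze
  created σ η y hy := by
    obtain ⟨h, hc, hN, hmem⟩ := hπ.created σ η y hy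
    exact ⟨h, hc, hN, hIJ hmem⟩

/-- After `i` rounds, the values of `i` nulls of `T` can be prescribed. -/
theorem IsIChaseR.exists_prescribes {D : Set (Atom ar C)} {R : Set (Rule ar C V)} (hShy : Shy R)
    (hD : D.Finite) {T : Set (OTerm ar C V)} (hT : T.Finite)
    (hTD : ∀ t ∈ T, ∃ σ η y, t = .null σ η y ∧ OChaseMem D R (firedHead σ η))
    {i : ℕ} {I : Set (Atom ar (ITerm C))} (h : IsIChaseR D R i I) :
    ∃ N π, N ⊆ T ∧ Prescribes (Atom.map ITerm.freeze '' I) N π ∧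
      (∀ n ∈ N, ∀ m ∈ T, m.InFiring n → m ∈ N) ∧ min i T.ncard ≤ N.ncard := by
  induction h with
  | zero =>
    -- With `N` empty, the value `.null 0` is never consulted.
    exact ⟨∅, fun t => match t with
      | .const c => .const c
      | .null _ _ _ => .null 0, Set.empty_subset _, ⟨fun _ => rfl, fun _ h => h.elim,
      fun _ _ _ h => h.elim⟩, fun _ h => h.elim, by simp⟩
  | succ i I J hI hJ ih =>
    obtain ⟨N, π, hNT, hπ, hcl, hcard⟩ := ih
    have hIJ : Atom.map ITerm.freeze '' I ⊆ Atom.map ITerm.freeze '' J := by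
      rintro _ ⟨a, ha, rfl⟩
      exact ⟨_, hJ.subset ⟨a, ha, rfl⟩, Atom.ext_of_args fun i => ITerm.freeze_freeze _⟩
    by_cases hTN : T ⊆ N
    · exact ⟨N, π, hNT, hπ.mono hIJ, hcl,
        (min_le_right _ _).trans (Set.ncard_le_ncard hTN (hT.subset hNT))⟩
    -- By minimality, the values of the creating firing that lie in `T` are already in `N`. The
    -- nulls of `T` created together with `n` are added at the same time, so `N` stays closed.
    obtain ⟨n, ⟨hnT, hnN⟩, hmin⟩ := OTerm.wellFounded_sub.has_min (T \ N)
      (Set.sdiff_nonempty.2 hTN)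
    obtain ⟨σ, η, y, rfl, hmem⟩ := hTD n hnT
    obtain ⟨π', hπ'⟩ := hπ.extend hIJ hcl (hmem.mapsInto hShy hJ.subset hJ.2
      (hJ.finite ((hI.finite hD).image _)) hI.base_subset hπ)
    refine ⟨_, π', Set.union_subset hNT Set.inter_subset_left, hπ', ?_, ?_⟩
    · rintro n' (hn' | ⟨-, y', rfl⟩) m hm hmn
      · exact Or.inl (hcl n' hn' m hm hmn)
      · cases hmn with
        | value _ _ _ b =>
          left
          by_contra hmN
          exact hmin _ ⟨hm, hmN⟩ (.mk σ η y b)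
        | created _ _ _ z => exact Or.inr ⟨hm, z, rfl⟩
    · have hsub : insert (OTerm.null σ η y) N ⊆ N ∪ (T ∩ Set.range (OTerm.null σ η)) :=
        Set.insert_subset (Or.inr ⟨hnT, y, rfl⟩) Set.subset_union_left
      have h1 := Set.ncard_le_ncard hsub
        (hT.subset (Set.union_subset hNT Set.inter_subset_left))
      rw [Set.ncard_insert_of_notMem hnN (hT.subset hNT)] at h1
      omega

theorem IsIChaseR.entails_of_ochase {D : Set (Atom ar C)} {R : Set (Rule ar C V)} (hShy : Shy R)
    (hD : D.Finite) {q : BCQ ar C V} {J : Set (Atom ar (ITerm C))}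
    (h : IsIChaseR D R ((conjVars q).ncard + 1) J)
    (hq : Entails OTerm.const (ochase D R) q) : Entails ITerm.const J q := by
  obtain ⟨θ, hθ⟩ := hq
  have hqfin : (conjVars q).Finite := conjVars_finite q
  set T : Set (OTerm ar C V) := {t ∈ θ '' conjVars q | ∀ c, t ≠ .const c}
  have hTsub : T ⊆ θ '' conjVars q := fun t ht => ht.1
  have hT : T.Finite := (hqfin.image θ).subset hTsub
  have hTcard : T.ncard ≤ (conjVars q).ncard :=
    (Set.ncard_le_ncard hTsub (hqfin.image θ)).trans (Set.ncard_image_le hqfin)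
  have hTD : ∀ t ∈ T, ∃ σ η y, t = .null σ η y ∧ OChaseMem D R (firedHead σ η) := by
    rintro _ ⟨⟨x, ⟨a, ha, i, hi⟩, rfl⟩, hx⟩
    cases ht : θ x with
    | const c => exact absurd ht (hx c)
    | null σ η y =>
      refine ⟨σ, η, y, rfl, OChaseMem.firedHead_mem (hθ a ha) (i := i) (y := y) ?_⟩
      show (a.args i).eval OTerm.const θ = _
      rw [hi]
      exact ht
  -- The last round is split off: the earlier `(conjVars q).ncard` rounds prescribe all of `T`, and
  -- the last one maps the atoms of `q`.
  obtain _ | ⟨_, I, _, hI, hJ⟩ := h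
  obtain ⟨N, π, hNT, hπ, -, hcard⟩ := hI.exists_prescribes hShy hD hT hTD
  have hTN : N = T := Set.eq_of_subset_of_ncard_le hNT (by omega) hT
  subst hTN
  refine ⟨fun x => π (θ x), fun a ha => ?_⟩
  obtain ⟨k, hc, hk, hmem⟩ := OChaseMem.mapsInto hShy hJ.subset hJ.2
    (hJ.finite ((hI.finite hD).image _)) hI.base_subset hπ (hθ a ha)
  rwa [Atom.map_inst (ι := OTerm.const) hc a (θ' := fun x => π (θ x))] at hmem
  rintro x ⟨i, hi⟩
  cases ht : θ x with
  | const c => rw [hc, hπ.const]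
  | null σ η y =>
    have := hk i
    simp only [Atom.inst, hi, RTerm.eval] at this
    rw [← ht]
    exact this ⟨⟨x, ⟨a, ha, i, hi⟩, rfl⟩, fun c hxc => by simp [ht] at hxc⟩

end Completeness
end Chase

theorem mainTheorem3 {P C V : Type*} [Nonempty C] (ar : P → ℕ)
    (R : Set (Chase.Rule ar C V)) (hR : R.Finite) (hShy : Chase.Shy R)
    (D : Set (Chase.Atom ar C)) (hD : D.Finite) (q : Chase.BCQ ar C V) :
    (∃ J, Chase.IsIChaseR D R ((Chase.conjVars q).ncard + 1) J) ∧
    ∀ J, Chase.IsIChaseR D R ((Chase.conjVars q).ncard + 1) J →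
      (Chase.Entails Chase.OTerm.const (Chase.ochase D R) q ↔
        Chase.Entails Chase.ITerm.const J q) :=
  ⟨Chase.exists_isIChaseR hD hR _, fun _ hJ =>
    ⟨hJ.entails_of_ochase hShy hD, hJ.entails_ochase⟩⟩
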